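/- **Notation.** For a closed set $S\subseteq\mathbb{R}^d$ let $\pi_S(x)$ be the set of points of $S$ closest to $x$, and let $\operatorname{ax}(S)=\{x : \#\pi_S(x)>1\}$ be its medial axis. For $p\in S$ and $v\in\mathbb{R}^d$ put $d(p,v,\pi_S)=\sup\{\lambda\in\mathbb{R} : \pi_S(p+\lambda v)=\{p\}\}\in[0,\infty]$, and let $\operatorname{UBP}(S)$ be the set of pairs $(p,u)$ with $p\in S$, $|u|=1$ and $0<d(p,u,\pi_S)<\infty$. For $(p,u)\in \operatorname{UBP}(S)$ put $\pi_{\operatorname{ax},S}(p,u)=p+d(p,u,\pi_S)\,u$. Let $\operatorname{Tan}(p,S)$ consist of $0$ and of all $u\ne 0$ such that for every $\varepsilon>0$ there is $q\in S$ with $0<|q-p|<\varepsilon$ and $\left|\frac{q-p}{|q-p|}-\frac{u}{|u|}\right|<\varepsilon$, and let $\operatorname{Nor}(p,S)=\{v : \langle v,u\rangle\le 0\ \text{for all } u\in\operatorname{Tan}(p,S)\}$. A closed ball $B(c,\rho)$ is weakly tangent to $S$ at $p\in S$ if $c-p\in\operatorname{Nor}(p,S)$ and $\rho=|c-p|$.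 It is a maximal empty weakly tangent ball to $S$ at $p$ with internal normal $u$ if moreover $(p,u)\in\operatorname{UBP}(S)$, $\rho=d(p,u,\pi_S)$ and $c=p+\rho u$. The Hausdorff distance is $d_H$, with values in $[0,\infty]$; $|\cdot|$ is the Euclidean norm and $\|\cdot\|$ the operator norm. **Theorem.** Let $S\subseteq\mathbb{R}^d$ be a closed set contained in a closed ball of radius $r>0$ whose boundary sphere $S(r)$ is contained in $S$. Let $F:\mathbb{R}^d\to\mathbb{R}^d$ be a $C^1$ diffeomorphism such that $F$ and $F^{-1}$ are Lipschitz with constant $L_F$, the differentials $DF$ and $D(F^{-1})$ are Lipschitz with constant $L_{DF}$, and $F(S(r))=S(r)$. (1) Let $c\in\operatorname{ax}(S)$, $p\in\pi_S(c)$, $\rho=|c-p|$, $u=\frac{c-p}{|c-p|}$, $T=u^\perp$ and $$u'=\frac{(D_pF^t)^{-1}u}{|(D_pF^t)^{-1}u|}.$$ Then $B(c,\rho)$ is a maximal empty weakly tangent ball to $S$ at $p$ with internal normal $u$. The vector $u'$ is a unit vector, $D_pF(T)=u'^\perp$, and $u'$ points at $F(p)$ into the image of the ball, that is, $F(p)+tu'$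 lies in the image under $F$ of the open ball with centre $c$ and radius $\rho$ for all sufficiently small $t>0$. There is a maximal empty weakly tangent ball $B(c',\rho')$ to $F(S)$ at $F(p)$ with internal normal $u'$. It is tangent to the affine subspace $F(p)+D_pF(T)$, meeting it only in $F(p)$. Its radius satisfies $$\rho'\ge\frac{\rho}{L_F^3+\rho L_{DF}L_F^2},\qquad\text{and}\qquad \rho'\le\frac{L_F^3\rho}{1-\rho L_{DF}L_F^2}\quad\text{if }\rho L_{DF}L_F^2<1.$$ (2) Suppose moreover that $|F(x)-x|\le\varepsilon_1$ and $\|D_xF-\operatorname{Id}\|\le\varepsilon_2<1$ for all $x\in\mathbb{R}^d$, and that $r L_{DF}L_F^2\le 1/2$. Put $$\Delta=2r\sqrt{1+L_F^6\left(1+4rL_{DF}L_F^2\right)^2-2L_F^3\left(1+4rL_{DF}L_F^2\right)\sqrt{1-\varepsilon_2^2}}+\varepsilon_1.$$ Then, for all $c,p,u,u'$ as in (1), $$\left|\pi_{\operatorname{ax},S}(p,u)-\pi_{\operatorname{ax},F(S)}(F(p),u')\right|\le\Delta,$$ and $$d_H\left(\operatorname{ax}(S),\operatorname{ax}(F(S))\right)\le\Delta,\qquad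 d_H\left(\overline{\operatorname{ax}(S)},\overline{\operatorname{ax}(F(S))}\right)\le\Delta.$$ -/

import Mathlib

open Set Filter Topology Metric
open scoped NNReal ENNReal InnerProductSpace

/-- The set of points of `S` closest to `x`. -/
def closestPoints {d : ℕ} (S : Set (EuclideanSpace ℝ (Fin d))) (x : EuclideanSpace ℝ (Fin d)) :
    Set (EuclideanSpace ℝ (Fin d)) :=
  {q | q ∈ S ∧ dist x q = infDist x S}

/-- The medial axis: the points with more than one closest point in `S`. -/
def medialAxis {d : ℕ} (S : Set (EuclideanSpace ℝ (Fin d))) : Set (EuclideanSpace ℝ (Fin d)) :=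
  {x | (closestPoints S x).Nontrivial}

/-- The projection range of `S` at `p` in the direction `v`, an extended real number. -/
noncomputable def projectionRange {d : ℕ} (S : Set (EuclideanSpace ℝ (Fin d)))
    (p v : EuclideanSpace ℝ (Fin d)) : EReal :=
  sSup ((fun t : ℝ => (t : EReal)) '' {t : ℝ | closestPoints S (p + t • v) = {p}})

/-- The pairs `(p, u)` of a point `p` of `S` and a unit back projection vector `u` of `S` at `p`. -/
def UBP {d : ℕ} (S : Set (EuclideanSpace ℝ (Fin d))) :
    Set (EuclideanSpace ℝ (Fin d) × EuclideanSpace ℝ (Fin d)) :=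
  {x | x.1 ∈ S ∧ ‖x.2‖ = 1 ∧ 0 < projectionRange S x.1 x.2 ∧ projectionRange S x.1 x.2 < ⊤}

/-- The map `(p, u) ↦ p + d(p, u, π_S) u`; meaningful for `(p, u) ∈ UBP S`, where the projection
range is finite. -/
noncomputable def axisProjection {d : ℕ} (S : Set (EuclideanSpace ℝ (Fin d)))
    (p u : EuclideanSpace ℝ (Fin d)) : EuclideanSpace ℝ (Fin d) :=
  p + (projectionRange S p u).toReal • u

/-- The generalized tangent space of `S` at `p`. -/
def generalizedTangent {d : ℕ} (S : Set (EuclideanSpace ℝ (Fin d)))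
    (p : EuclideanSpace ℝ (Fin d)) : Set (EuclideanSpace ℝ (Fin d)) :=
  {u | u = 0 ∨ ∀ ε : ℝ, 0 < ε → ∃ q ∈ S, 0 < ‖q - p‖ ∧ ‖q - p‖ < ε ∧
    ‖‖q - p‖⁻¹ • (q - p) - ‖u‖⁻¹ • u‖ < ε}

/-- The generalized normal space of `S` at `p`. -/
def generalizedNormal {d : ℕ} (S : Set (EuclideanSpace ℝ (Fin d)))
    (p : EuclideanSpace ℝ (Fin d)) : Set (EuclideanSpace ℝ (Fin d)) :=
  {v | ∀ u ∈ generalizedTangent S p, ⟪v, u⟫_ℝ ≤ 0}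

/-- The ball with centre `c` and radius `ρ` is weakly tangent to `S` at `p`. -/
def IsWeaklyTangentBall {d : ℕ} (S : Set (EuclideanSpace ℝ (Fin d)))
    (p c : EuclideanSpace ℝ (Fin d)) (ρ : ℝ) : Prop :=
  p ∈ S ∧ c - p ∈ generalizedNormal S p ∧ ρ = ‖c - p‖

/-- The ball with centre `c` and radius `ρ` is a maximal empty weakly tangent ball to `S` at `p`,
and the boundary sphere has the internal unit normal `u` at `p`. -/
structure IsMaximalEmptyBall {d : ℕ} (S : Set (EuclideanSpace ℝ (Fin d)))
    (p u c : EuclideanSpace ℝ (Fin d)) (ρ : ℝ) : Prop where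
  mem_UBP : (p, u) ∈ UBP S
  weaklyTangent : IsWeaklyTangentBall S p c ρ
  center_eq : c = p + ρ • u
  radius_eq : (ρ : EReal) = projectionRange S p u

/-- `F` is a `C^{1,1}` diffeomorphism of `ℝ^d`: `F` and its inverse are `C¹` and `LF`-Lipschitz,
and the differentials of `F` and of its inverse are `LDF`-Lipschitz for the operator norm. -/
structure IsC11Diffeo {d : ℕ} (F : EuclideanSpace ℝ (Fin d) ≃ EuclideanSpace ℝ (Fin d))
    (LF LDF : ℝ≥0) : Prop where
  contDiff : ContDiff ℝ 1 F
  contDiff_symm : ContDiff ℝ 1 F.symm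
  lipschitz : LipschitzWith LF F
  lipschitz_symm : LipschitzWith LF F.symm
  lipschitz_fderiv : LipschitzWith LDF (fderiv ℝ F)
  lipschitz_fderiv_symm : LipschitzWith LDF (fderiv ℝ F.symm)

/-- The vector `(D_pF^t)⁻¹ u / |(D_pF^t)⁻¹ u|`. -/
noncomputable def imageNormal {d : ℕ}
    (F : EuclideanSpace ℝ (Fin d) → EuclideanSpace ℝ (Fin d)) (p u : EuclideanSpace ℝ (Fin d)) :
    EuclideanSpace ℝ (Fin d) :=
  ‖(ContinuousLinearMap.adjoint (fderiv ℝ F p)).inverse u‖⁻¹ •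
    (ContinuousLinearMap.adjoint (fderiv ℝ F p)).inverse u

/-- The right-hand side of the distance estimates. -/
noncomputable def distortionBound (r LF LDF ε₁ ε₂ : ℝ) : ℝ :=
  2 * r * √(1 + LF ^ 6 * (1 + 4 * r * LDF * LF ^ 2) ^ 2
    - 2 * LF ^ 3 * (1 + 4 * r * LDF * LF ^ 2) * √(1 - ε₂ ^ 2)) + ε₁

/-! ### Empty balls and the projection range -/

section

variable {d : ℕ} {S : Set (EuclideanSpace ℝ (Fin d))} {p u x q : EuclideanSpace ℝ (Fin d)}

/-! The ball of radius R touching p from the side of u has no point of S inside exactly when 2R⟨s −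
p, u⟩ ≤ |s − p|² for all s ∈ S (`IsEmptyBall`), and the projection range is the largest such R. This
inequality can be transported by F. By Taylor's formula for F⁻¹ at F(p), ⟨s − p, u⟩ equals b⟨F(s) −
F(p), u'⟩ with b ≥ 1/L_F, up to an error of at most L_DF |F(s) − F(p)|²/2. Hence an empty ball for S
gives one of explicit radius for F(S) with normal u' (`isEmptyBall_image`). The same construction
for F⁻¹ takes (F(p), u') back to (p, u), so the lower radius bound for F⁻¹ is the upper bound for F.
The new radius is finite, at most r, because u' points into the ball whose boundary sphere lies in
F(S).

For (2), the two centres are compared by the law of cosines: ε₂ controls the angle, (1) the ratio of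
the radii, ε₁ the shift of p. The end of a finite projection range may miss the medial axis, but
lies in its closure (`add_smul_mem_closure_medialAxis`): away from the medial axis the distance to S
can be increased at unit rate, which would enlarge the empty ball. This suffices for the Hausdorff
distance. -/

theorem mem_closestPoints_iff : q ∈ closestPoints S x ↔ q ∈ S ∧ ∀ s ∈ S, dist x q ≤ dist x s := by
  constructor
  · rintro ⟨hq, h⟩
    exact ⟨hq, fun s hs => h ▸ infDist_le_dist_of_mem hs⟩
  · rintro ⟨hq, h⟩
    exact ⟨hq, le_antisymm ((le_infDist ⟨q, hq⟩).2 fun s hs => h s hs) (infDist_le_dist_of_mem hq)⟩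

theorem closestPoints_eq_singleton_iff :
    closestPoints S x = {p} ↔ p ∈ S ∧ ∀ s ∈ S, s ≠ p → dist x p < dist x s := by
  constructor
  · intro h
    have hp : p ∈ closestPoints S x := h ▸ mem_singleton p
    refine ⟨hp.1, fun s hs hne => lt_of_le_of_ne ((mem_closestPoints_iff.1 hp).2 s hs) fun he => ?_⟩
    have : s ∈ closestPoints S x := ⟨hs, he ▸ hp.2⟩
    rw [h] at this
    exact hne this
  · rintro ⟨hp, h⟩
    ext s
    rw [mem_closestPoints_iff, mem_singleton_iff]
    constructor
    · rintro ⟨hs, h'⟩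
      by_contra hne
      exact absurd (h' p hp) (not_le.2 (h s hs hne))
    · rintro rfl
      refine ⟨hp, fun t ht => ?_⟩
      by_cases hts : t = s
      · rw [hts]
      · exact (h t ht hts).le

theorem dist_add_smul_sq (p u s : EuclideanSpace ℝ (Fin d)) (t : ℝ) :
    dist (p + t • u) s ^ 2 =
      dist (p + t • u) p ^ 2 + (‖s - p‖ ^ 2 - 2 * t * ⟪s - p, u⟫_ℝ) := by
  have h1 : p + t • u - s = t • u - (s - p) := by abel
  have h2 : p + t • u - p = t • u := by abel
  rw [dist_eq_norm, dist_eq_norm, h1, h2, norm_sub_sq_real, real_inner_smul_left,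
    real_inner_comm]
  ring

theorem dist_add_smul_le_iff {s : EuclideanSpace ℝ (Fin d)} {t : ℝ} :
    dist (p + t • u) p ≤ dist (p + t • u) s ↔ 2 * t * ⟪s - p, u⟫_ℝ ≤ ‖s - p‖ ^ 2 := by
  rw [← sq_le_sq₀ dist_nonneg dist_nonneg, dist_add_smul_sq p u s t]
  constructor <;> intro h <;> linarith

theorem dist_add_smul_lt_iff {s : EuclideanSpace ℝ (Fin d)} {t : ℝ} :
    dist (p + t • u) p < dist (p + t • u) s ↔ 2 * t * ⟪s - p, u⟫_ℝ < ‖s - p‖ ^ 2 := by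
  rw [← sq_lt_sq₀ dist_nonneg dist_nonneg, dist_add_smul_sq p u s t]
  constructor <;> intro h <;> linarith

/-- The ball of radius `R` that touches `p` from the side of the unit vector `u` contains no point
of `S` in its interior. -/
def IsEmptyBall {d : ℕ} (S : Set (EuclideanSpace ℝ (Fin d)))
    (p u : EuclideanSpace ℝ (Fin d)) (R : ℝ) : Prop :=
  ∀ s ∈ S, 2 * R * ⟪s - p, u⟫_ℝ ≤ ‖s - p‖ ^ 2

theorem mem_closestPoints_add_smul_iff {R : ℝ} :
    p ∈ closestPoints S (p + R • u) ↔ p ∈ S ∧ IsEmptyBall S p u R := by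
  simp only [mem_closestPoints_iff, dist_add_smul_le_iff, IsEmptyBall]

theorem IsEmptyBall.mono {R R' : ℝ} (h : IsEmptyBall S p u R) (hR' : 0 ≤ R') (hle : R' ≤ R) :
    IsEmptyBall S p u R' := by
  intro s hs
  rcases le_or_gt ⟪s - p, u⟫_ℝ 0 with hi | hi
  · exact (mul_nonpos_of_nonneg_of_nonpos (by positivity) hi).trans (by positivity)
  · refine le_trans ?_ (h s hs)
    gcongr

theorem IsEmptyBall.closestPoints_eq {R t : ℝ} (h : IsEmptyBall S p u R) (hp : p ∈ S)
    (ht : 0 ≤ t) (hlt : t < R) : closestPoints S (p + t • u) = {p} := by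
  rw [closestPoints_eq_singleton_iff]
  refine ⟨hp, fun s hs hne => dist_add_smul_lt_iff.2 ?_⟩
  have hpos : 0 < ‖s - p‖ ^ 2 := by
    have : 0 < ‖s - p‖ := norm_pos_iff.2 (sub_ne_zero.2 hne)
    positivity
  rcases le_or_gt ⟪s - p, u⟫_ℝ 0 with hi | hi
  · exact (mul_nonpos_of_nonneg_of_nonpos (by positivity) hi).trans_lt hpos
  · refine lt_of_lt_of_le ?_ (h s hs)
    gcongr

/-- Emptiness passes to smaller radii and to limits of radii, so it holds up to and including the
supremum, where uniqueness of the closest point may fail. Conversely, strictly smaller balls touch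
the sphere only at p, so their centres project to p alone. -/
theorem coe_le_projectionRange_iff (hp : p ∈ S) {R : ℝ} (hR : 0 < R) :
    (R : EReal) ≤ projectionRange S p u ↔ IsEmptyBall S p u R := by
  constructor
  · intro h
    have key : ∀ R' : ℝ, 0 ≤ R' → R' < R → IsEmptyBall S p u R' := by
      intro R' h0 hlt
      have : (R' : EReal) < projectionRange S p u := lt_of_lt_of_le (by exact_mod_cast hlt) h
      obtain ⟨_, ⟨t, ht, rfl⟩, hRt⟩ := lt_sSup_iff.1 this
      have hp' : p ∈ closestPoints S (p + t • u) := by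
        rw [show closestPoints S (p + t • u) = {p} from ht]
        exact mem_singleton p
      exact (mem_closestPoints_add_smul_iff.1 hp').2.mono h0 (EReal.coe_lt_coe_iff.1 hRt).le
    intro s hs
    have hcont : Tendsto (fun R' : ℝ => 2 * R' * ⟪s - p, u⟫_ℝ) (𝓝[<] R)
        (𝓝 (2 * R * ⟪s - p, u⟫_ℝ)) :=
      (Continuous.tendsto (by fun_prop) R).mono_left nhdsWithin_le_nhds
    refine le_of_tendsto hcont ?_
    filter_upwards [Ioo_mem_nhdsLT hR] with R' hR' using key R' hR'.1.le hR'.2 s hs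
  · intro h
    refine le_of_forall_lt fun b hb => ?_
    -- The maximum with 0 makes t positive; uniqueness of the closest point is only available for t
    -- ≥ 0.
    obtain ⟨t, hbt, htR⟩ := EReal.lt_iff_exists_real_btwn.1 (max_lt hb
      (show ((0 : ℝ) : EReal) < R by exact_mod_cast hR))
    have ht0 : 0 < t := by exact_mod_cast (le_max_right _ _).trans_lt hbt
    exact ((le_max_left _ _).trans_lt hbt).trans_le
      (le_sSup ⟨t, h.closestPoints_eq hp ht0.le (by exact_mod_cast htR), rfl⟩)

theorem exists_projectionRange_eq (hp : p ∈ S) {R₀ B : ℝ} (hR₀ : 0 < R₀)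
    (h₀ : IsEmptyBall S p u R₀) (hB : ∀ R, 0 < R → IsEmptyBall S p u R → R ≤ B) :
    ∃ ρ : ℝ, projectionRange S p u = ρ ∧ R₀ ≤ ρ ∧ ρ ≤ B ∧ IsEmptyBall S p u ρ := by
  have h1 : (R₀ : EReal) ≤ projectionRange S p u := (coe_le_projectionRange_iff hp hR₀).2 h₀
  have h2 : projectionRange S p u ≤ B := by
    refine le_of_forall_lt fun b hb => ?_
    obtain ⟨t, hbt, htR⟩ := EReal.lt_iff_exists_real_btwn.1 hb
    rcases lt_or_ge 0 t with ht | ht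
    · exact hbt.trans_le (by exact_mod_cast hB t ht ((coe_le_projectionRange_iff hp ht).1 htR.le))
    · exact hbt.trans_le (by exact_mod_cast ht.trans (hR₀.le.trans (hB _ hR₀ h₀)))
  have h3 : projectionRange S p u ≠ ⊤ := (h2.trans_lt (EReal.coe_lt_top B)).ne
  have h4 : projectionRange S p u ≠ ⊥ := ((EReal.bot_lt_coe R₀).trans_le h1).ne'
  have h5 := EReal.coe_toReal h3 h4
  rw [← h5] at h1 h2
  have h6 : R₀ ≤ (projectionRange S p u).toReal := by exact_mod_cast h1
  exact ⟨_, h5.symm, h6, by exact_mod_cast h2,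
    (coe_le_projectionRange_iff hp (hR₀.trans_le h6)).1 h5.le⟩

/-- Dividing the emptiness inequality by |q − p| bounds the cosine between q − p and u by |q −
p|/(2R), which tends to 0 as q approaches p along a tangent direction. -/
theorem IsEmptyBall.smul_mem_generalizedNormal {R : ℝ} (h : IsEmptyBall S p u R) (hR : 0 < R) :
    R • u ∈ generalizedNormal S p := by
  intro v hv
  rcases hv with rfl | hv
  · simp
  rcases eq_or_ne v 0 with rfl | hv0
  · simp
  have hvn : 0 < ‖v‖ := norm_pos_iff.2 hv0
  suffices hs : ⟪‖v‖⁻¹ • v, u⟫_ℝ ≤ 0 by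
    rw [real_inner_smul_left] at hs
    have : ⟪v, u⟫_ℝ ≤ 0 := by
      by_contra hcon
      push Not at hcon
      exact absurd hs (not_le.2 (by positivity))
    rw [real_inner_smul_left, real_inner_comm]
    exact mul_nonpos_of_nonneg_of_nonpos hR.le this
  refine le_of_forall_pos_le_add fun ε hε => ?_
  have hC : 0 < (2 * R)⁻¹ + ‖u‖ := by positivity
  obtain ⟨q, hq, hq0, hqlt, hqv⟩ := hv (ε / ((2 * R)⁻¹ + ‖u‖)) (by positivity)
  set ε' := ε / ((2 * R)⁻¹ + ‖u‖)
  have h1 : ⟪‖q - p‖⁻¹ • (q - p), u⟫_ℝ ≤ (2 * R)⁻¹ * ε' := by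
    have := h q hq
    rw [real_inner_smul_left]
    have h2 : ⟪q - p, u⟫_ℝ ≤ (2 * R)⁻¹ * ‖q - p‖ ^ 2 := by
      rw [inv_mul_eq_div, le_div_iff₀ (by positivity)]
      linarith
    calc ‖q - p‖⁻¹ * ⟪q - p, u⟫_ℝ ≤ ‖q - p‖⁻¹ * ((2 * R)⁻¹ * ‖q - p‖ ^ 2) := by gcongr
      _ = (2 * R)⁻¹ * ‖q - p‖ := by field_simp
      _ ≤ _ := by gcongr
  have h3 : ⟪‖v‖⁻¹ • v - ‖q - p‖⁻¹ • (q - p), u⟫_ℝ ≤ ε' * ‖u‖ := by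
    refine (real_inner_le_norm _ _).trans ?_
    rw [norm_sub_rev]
    gcongr
  rw [inner_sub_left] at h3
  have h4 : ((2 * R)⁻¹ + ‖u‖) * ε' = ε := mul_div_cancel₀ _ hC.ne'
  linarith

theorem isMaximalEmptyBall_of_projectionRange_eq {ρ : ℝ} (hp : p ∈ S) (hu : ‖u‖ = 1)
    (hρ : 0 < ρ) (h : projectionRange S p u = ρ) :
    IsMaximalEmptyBall S p u (p + ρ • u) ρ where
  mem_UBP := ⟨hp, hu, by simpa [h] using hρ, by simp [h]⟩
  weaklyTangent := by
    have he := (coe_le_projectionRange_iff hp hρ).1 h.ge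
    refine ⟨hp, ?_, ?_⟩
    · rw [add_sub_cancel_left]
      exact he.smul_mem_generalizedNormal hρ
    · rw [add_sub_cancel_left, norm_smul, hu, mul_one, Real.norm_of_nonneg hρ.le]
  center_eq := rfl
  radius_eq := h.symm

theorem closedBall_inter_hyperplane {ρ : ℝ} (hu : ‖u‖ = 1) (hρ : 0 ≤ ρ) :
    closedBall (p + ρ • u) ρ ∩ ((fun v => p + v) '' ((ℝ ∙ u)ᗮ : Set _)) = {p} := by
  have hn : ‖ρ • u‖ = ρ := by rw [norm_smul, hu, mul_one, Real.norm_of_nonneg hρ]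
  ext y
  simp only [mem_inter_iff, mem_closedBall, mem_image, SetLike.mem_coe, mem_singleton_iff,
    Submodule.mem_orthogonal_singleton_iff_inner_left]
  constructor
  · rintro ⟨hy, v, hv, rfl⟩
    have h1 : p + v - (p + ρ • u) = v - ρ • u := by abel
    rw [dist_eq_norm, h1] at hy
    have h2 := norm_sub_sq_real v (ρ • u)
    rw [real_inner_smul_right, hv, hn] at h2
    have h3 : ‖v‖ ^ 2 ≤ 0 := by nlinarith [norm_nonneg (v - ρ • u)]
    have h4 : v = 0 := by simpa using le_antisymm h3 (by positivity)
    simp [h4]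
  · rintro rfl
    refine ⟨?_, 0, by simp, by simp⟩
    rw [dist_eq_norm, sub_add_cancel_left, norm_neg, hn]

/-- A point of the medial axis lies at the end of the projection range of each of its closest
points. -/
theorem projectionRange_of_mem_medialAxis {c : EuclideanSpace ℝ (Fin d)} (hc : c ∈ medialAxis S)
    (hp : p ∈ closestPoints S c) :
    0 < ‖c - p‖ ∧ ‖‖c - p‖⁻¹ • (c - p)‖ = 1 ∧ c = p + ‖c - p‖ • (‖c - p‖⁻¹ • (c - p)) ∧
      projectionRange S p (‖c - p‖⁻¹ • (c - p)) = ‖c - p‖ := by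
  obtain ⟨q, hq, hqp⟩ := hc.exists_ne p
  have hd : dist c q = dist c p := hq.2.trans hp.2.symm
  have hpos : 0 < ‖c - p‖ := by
    rw [norm_pos_iff, sub_ne_zero]
    rintro rfl
    rw [dist_self, dist_eq_zero] at hd
    exact hqp hd.symm
  have hu : ‖‖c - p‖⁻¹ • (c - p)‖ = 1 := by
    rw [norm_smul, norm_inv, norm_norm, inv_mul_cancel₀ hpos.ne']
  have hcp : c = p + ‖c - p‖ • (‖c - p‖⁻¹ • (c - p)) := by
    rw [smul_smul, mul_inv_cancel₀ hpos.ne', one_smul, add_sub_cancel]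
  refine ⟨hpos, hu, hcp, ?_⟩
  set u := ‖c - p‖⁻¹ • (c - p)
  set ρ := ‖c - p‖
  have hE : IsEmptyBall S p u ρ := by
    rw [hcp] at hp
    exact (mem_closestPoints_add_smul_iff.1 hp).2
  -- A second closest point q lies on the sphere of radius ρ about c, so it turns the emptiness
  -- inequality into an equality at ρ and violates it beyond.
  have hB : ∀ R, 0 < R → IsEmptyBall S p u R → R ≤ ρ := by
    intro R hR h
    have h1 := h q hq.1
    have h2 : ¬ 2 * ρ * ⟪q - p, u⟫_ℝ < ‖q - p‖ ^ 2 := by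
      rw [← dist_add_smul_lt_iff, ← hcp, hd]
      exact lt_irrefl _
    push Not at h2
    have h3 : 0 < ‖q - p‖ := norm_pos_iff.2 (sub_ne_zero.2 hqp)
    have h4 : 0 < 2 * ρ * ⟪q - p, u⟫_ℝ := lt_of_lt_of_le (by positivity) h2
    have h5 : 0 < ⟪q - p, u⟫_ℝ := pos_of_mul_pos_right h4 (by positivity)
    have h6 := h1.trans h2
    have := le_of_mul_le_mul_right h6 h5
    linarith
  obtain ⟨ρ', h1, h2, h3, -⟩ := exists_projectionRange_eq hp.1 hpos hE hB
  rw [h1, le_antisymm h3 h2]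

end

/-! ### The distance function off the medial axis -/

section

variable {d : ℕ} {S : Set (EuclideanSpace ℝ (Fin d))} {p u x q : EuclideanSpace ℝ (Fin d)}

theorem closestPoints_nonempty (hS : IsClosed S) (hne : S.Nonempty)
    (x : EuclideanSpace ℝ (Fin d)) : (closestPoints S x).Nonempty := by
  obtain ⟨q, hq, h⟩ := hS.exists_infDist_eq_dist hne x
  exact ⟨q, hq, h.symm⟩

/-- Closest points of nearby points are close to the closest point, if the latter is unique. -/
theorem eventually_closestPoints_subset_ball (hS : IsClosed S)
    (h : closestPoints S x = {q}) {ε : ℝ} (hε : 0 < ε) :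
    ∀ᶠ y in 𝓝 x, closestPoints S y ⊆ ball q ε := by
  -- By compactness, closest points staying away from q would accumulate at another closest point of
  -- x.
  by_contra hcon
  have hfreq : ∃ᶠ y in 𝓝 x, ∃ z ∈ closestPoints S y, z ∉ ball q ε := by
    exact (not_eventually.1 hcon).mono fun y hy => not_subset.1 hy
  obtain ⟨y, hyx, hy⟩ := exists_seq_forall_of_frequently hfreq
  choose z hz hzq using hy
  have hqS : q ∈ closestPoints S x := h ▸ mem_singleton q
  have hdist : ∀ n, dist (y n) (z n) = infDist (y n) S := fun n => (hz n).2
  have hlim : Tendsto (fun n => dist (y n) (z n)) atTop (𝓝 (infDist x S)) := by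
    simp only [hdist]
    exact ((continuous_infDist_pt S).tendsto x).comp hyx
  have hbdd : ∃ R, ∀ n, z n ∈ closedBall x R := by
    have h1 : Tendsto (fun n => dist (z n) (y n) + dist (y n) x) atTop
        (𝓝 (infDist x S + dist x x)) := by
      simp only [dist_comm (z _)]
      exact hlim.add (hyx.dist tendsto_const_nhds)
    obtain ⟨R, hR⟩ := h1.bddAbove_range
    exact ⟨R, fun n => (dist_triangle _ _ _).trans (hR ⟨n, rfl⟩)⟩
  obtain ⟨R, hR⟩ := hbdd
  obtain ⟨w, -, φ, hφ, hw⟩ := (isCompact_closedBall x R).tendsto_subseq hR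
  have hwS : w ∈ S := hS.mem_of_tendsto hw (Eventually.of_forall fun n => (hz _).1)
  have hwd : dist x w = infDist x S :=
    tendsto_nhds_unique ((hyx.comp hφ.tendsto_atTop).dist hw) (hlim.comp hφ.tendsto_atTop)
  have hwq : w = q := by
    have : w ∈ closestPoints S x := ⟨hwS, hwd⟩
    rw [h] at this
    exact this
  have : w ∈ (ball q ε)ᶜ :=
    isOpen_ball.isClosed_compl.mem_of_tendsto hw (Eventually.of_forall fun n => hzq _)
  exact this (hwq ▸ mem_ball_self hε)

/-- Moving away from a unique closest point increases the distance at unit rate. -/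
theorem eventually_infDist_add_smul (hS : IsClosed S)
    (h : closestPoints S x = {q}) {n : EuclideanSpace ℝ (Fin d)} (hn : ‖n‖ = 1)
    {δ : ℝ} (hδ : 0 < δ) (hxq : x = q + δ • n) {η : ℝ} (hη : 0 < η)
    (hη1 : η < 1) : ∀ᶠ t in 𝓝[>] (0 : ℝ), infDist x S + (1 - η) * t < infDist (x + t • n) S := by
  have hne : S.Nonempty := ⟨q, (h ▸ mem_singleton q : q ∈ closestPoints S x).1⟩
  have hδS : infDist x S = δ := by
    rw [← (h ▸ mem_singleton q : q ∈ closestPoints S x).2, hxq, dist_eq_norm,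
      add_sub_cancel_left, norm_smul, hn, mul_one, Real.norm_of_nonneg hδ.le]
  have hcont : Tendsto (fun t : ℝ => x + t • n) (𝓝[>] 0) (𝓝 x) := by
    have : Tendsto (fun t : ℝ => x + t • n) (𝓝 0) (𝓝 (x + (0 : ℝ) • n)) :=
      Continuous.tendsto (by fun_prop) 0
    rw [zero_smul, add_zero] at this
    exact this.mono_left nhdsWithin_le_nhds
  -- With |z − q| < δη/2, replacing q by z costs at most tδη in the squared distance, half of the
  -- margin 2tδη left by the slope 1 − η.
  have hev := hcont.eventually
    (eventually_closestPoints_subset_ball hS h (show 0 < δ * η / 2 by positivity))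
  filter_upwards [hev, Ioo_mem_nhdsGT (show 0 < δ * η / 2 by positivity),
    self_mem_nhdsWithin] with t ht htlt ht0
  obtain ⟨z, hz⟩ := closestPoints_nonempty hS hne (x + t • n)
  have hzq := ht hz
  rw [hδS, ← hz.2]
  rw [mem_Ioi] at ht0
  have h1 : δ ≤ ‖x - z‖ := by
    rw [← hδS, ← dist_eq_norm]
    exact infDist_le_dist_of_mem hz.1
  have h2 : ⟪x - z, n⟫_ℝ ≥ δ - δ * η / 2 := by
    have h3 : x - z = δ • n - (z - q) := by rw [hxq]; abel
    have h4 : ⟪z - q, n⟫_ℝ ≤ δ * η / 2 := by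
      refine (real_inner_le_norm _ _).trans ?_
      rw [hn, mul_one, ← dist_eq_norm]
      exact (mem_ball.1 hzq).le
    rw [h3, inner_sub_left, real_inner_smul_left, real_inner_self_eq_norm_sq, hn]
    linarith
  have h5 : x + t • n - z = (x - z) + t • n := by abel
  rw [dist_eq_norm, h5]
  have h6 := norm_add_sq_real (x - z) (t • n)
  rw [real_inner_smul_right, norm_smul, hn, mul_one, Real.norm_of_nonneg ht0.le] at h6
  refine lt_of_pow_lt_pow_left₀ 2 (norm_nonneg _) ?_
  rw [h6]
  have h7 : δ ^ 2 ≤ ‖x - z‖ ^ 2 := by gcongr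
  have h8 : t * (δ - δ * η / 2) ≤ t * ⟪x - z, n⟫_ℝ := by gcongr
  have h9 : (1 - η) ^ 2 ≤ 1 := by nlinarith
  have h10 : ((1 - η) * t) ^ 2 ≤ t ^ 2 := by
    rw [mul_pow]; nlinarith [sq_nonneg t]
  nlinarith [mul_pos (mul_pos hδ hη) ht0]

/-- Every point of the closed ball has a unique closest point, so from an interior point the
distance to S can be increased at a rate arbitrarily near 1. A maximum argument replaces the
gradient flow; ε < `infDist x S` keeps the ball off S. -/
theorem exists_infDist_ge_of_disjoint_medialAxis (hS : IsClosed S) (hne : S.Nonempty) {ε : ℝ}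
    (hε : 0 < ε) (hlt : ε < infDist x S) (hdisj : Disjoint (closedBall x ε) (medialAxis S)) :
    ∃ y ∈ closedBall x ε, infDist x S + ε ≤ infDist y S := by
  obtain ⟨y, hy, hmax⟩ := (isCompact_closedBall x ε).exists_isMaxOn
    ⟨x, mem_closedBall_self hε.le⟩ (continuous_infDist_pt S).continuousOn
  refine ⟨y, hy, ?_⟩
  suffices H : ∀ η : ℝ, 0 < η → infDist x S + (1 - η) * ε ≤ infDist y S by
    refine le_of_forall_pos_le_add fun a ha => ?_
    have := H (a / ε) (by positivity)
    rw [sub_mul, div_mul_cancel₀ _ hε.ne'] at this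
    linarith
  intro η hη
  wlog hη1 : η < 1 generalizing η
  · refine le_trans ?_ (hmax (mem_closedBall_self hε.le))
    nlinarith
  -- A maximiser of the distance penalised by slope 1 − η lies on the boundary: at an interior one,
  -- stepping away from its closest point would gain more than the penalty.
  obtain ⟨z, hz, hzmax⟩ := (isCompact_closedBall x ε).exists_isMaxOn
    ⟨x, mem_closedBall_self hε.le⟩
    (f := fun z => infDist z S - (1 - η) * dist z x) (by
      have := continuous_infDist_pt S
      fun_prop)
  have hzε : dist z x = ε := by
    refine le_antisymm hz (not_lt.1 fun hzlt => ?_)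
    obtain ⟨q, hq⟩ := closestPoints_nonempty hS hne z
    have hzS : closestPoints S z = {q} := by
      have : (closestPoints S z).Subsingleton :=
        not_nontrivial_iff.1 (Set.disjoint_left.1 hdisj hz)
      exact this.eq_singleton_of_mem hq
    have hzpos : 0 < ‖z - q‖ := by
      rw [← dist_eq_norm, hq.2]
      have := infDist_le_infDist_add_dist (s := S) (x := x) (y := z)
      rw [dist_comm] at this
      linarith
    have hev := eventually_infDist_add_smul hS hzS (n := ‖z - q‖⁻¹ • (z - q))
      (by rw [norm_smul, norm_inv, norm_norm, inv_mul_cancel₀ hzpos.ne']) hzpos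
      (by rw [smul_smul, mul_inv_cancel₀ hzpos.ne', one_smul, add_sub_cancel]) hη hη1
    obtain ⟨t, ht, ht0, htε⟩ := (hev.and (Ioo_mem_nhdsGT (sub_pos.2 hzlt))).exists
    set n := ‖z - q‖⁻¹ • (z - q) with hn
    have hn1 : ‖n‖ = 1 := by rw [hn, norm_smul, norm_inv, norm_norm, inv_mul_cancel₀ hzpos.ne']
    have hd : dist (z + t • n) x ≤ t + dist z x := by
      refine (dist_triangle _ z _).trans_eq ?_
      rw [dist_eq_norm, add_sub_cancel_left, norm_smul, hn1, mul_one, Real.norm_of_nonneg ht0.le]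
    have hm := hzmax (show z + t • n ∈ closedBall x ε from hd.trans (by linarith))
    simp only [mem_ofPred_eq] at hm
    have : (1 - η) * dist (z + t • n) x ≤ (1 - η) * (t + dist z x) := by
      have : 0 ≤ 1 - η := by linarith
      gcongr
    linarith
  have h1 := hzmax (mem_closedBall_self hε.le)
  have h2 := hmax hz
  simp only [mem_ofPred_eq, dist_self, mul_zero, sub_zero, hzε] at h1 h2
  linarith

/-- The end of a finite projection range lies in the closure of the medial axis. -/
theorem add_smul_mem_closure_medialAxis (hS : IsClosed S) (hp : p ∈ S) (hu : ‖u‖ = 1) {ρ : ℝ}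
    (hρ : 0 < ρ) (h : projectionRange S p u = ρ) : p + ρ • u ∈ closure (medialAxis S) := by
  by_contra hcon
  obtain ⟨ε₀, hε₀, hball⟩ := Metric.isOpen_iff.1 isClosed_closure.isOpen_compl _ hcon
  set x := p + ρ • u with hx
  have hxp : dist x p = ρ := by
    rw [hx, dist_eq_norm, add_sub_cancel_left, norm_smul, hu, mul_one, Real.norm_of_nonneg hρ.le]
  have hpx : p ∈ closestPoints S x :=
    mem_closestPoints_add_smul_iff.2 ⟨hp, (coe_le_projectionRange_iff hp hρ).1 h.ge⟩
  have hxS : infDist x S = ρ := by rw [← hpx.2, hxp]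
  set ε := min ε₀ ρ / 2
  have hm : 0 < min ε₀ ρ := lt_min hε₀ hρ
  have hε : 0 < ε := half_pos hm
  have hε1 : ε < ε₀ := (half_lt_self hm).trans_le (min_le_left _ _)
  have hε2 : ε < ρ := (half_lt_self hm).trans_le (min_le_right _ _)
  obtain ⟨y, hy, hyS⟩ := exists_infDist_ge_of_disjoint_medialAxis hS ⟨p, hp⟩ hε (hxS ▸ hε2)
    (Set.disjoint_left.2 fun z hz hz' =>
      hball (closedBall_subset_ball hε1 hz) (subset_closure hz'))
  have hyp : infDist y S ≤ dist y p := infDist_le_dist_of_mem hp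
  have hyε : ‖y - x‖ ≤ ε := by rw [← dist_eq_norm]; exact hy
  -- Here |y − p| ≥ ρ + ε while |x − p| = ρ and |y − x| ≤ ε. Equality in the triangle inequality
  -- puts y on the ray, and the ball of radius ρ + ε is then empty.
  have hyx : y - x = ε • u := by
    have h1 : y - p = (y - x) + ρ • u := by rw [hx]; abel
    have h2 : (ρ + ε) ^ 2 ≤ ‖y - p‖ ^ 2 := by
      rw [← dist_eq_norm]
      have : ρ + ε ≤ dist y p := by linarith
      gcongr
    rw [h1, norm_add_sq_real, real_inner_smul_right, norm_smul, hu, mul_one,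
      Real.norm_of_nonneg hρ.le] at h2
    have h3 : ‖y - x‖ ^ 2 ≤ ε ^ 2 := by gcongr
    have h4 : ε ≤ ⟪y - x, u⟫_ℝ := by
      have : ρ * ε ≤ ρ * ⟪y - x, u⟫_ℝ := by linarith
      exact le_of_mul_le_mul_left this hρ
    have h5 := norm_sub_sq_real (y - x) (ε • u)
    rw [real_inner_smul_right, norm_smul, hu, mul_one, Real.norm_of_nonneg hε.le] at h5
    have h6 : ‖y - x - ε • u‖ ^ 2 ≤ 0 := by nlinarith
    have h7 : ‖y - x - ε • u‖ = 0 := by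
      simpa using le_antisymm h6 (by positivity)
    exact sub_eq_zero.1 (norm_eq_zero.1 h7)
  have hyeq : y = p + (ρ + ε) • u := by
    rw [add_smul, ← add_assoc, ← hx, ← hyx, add_sub_cancel]
  have hyp' : dist y p = ρ + ε := by
    rw [hyeq, dist_eq_norm, add_sub_cancel_left, norm_smul, hu, mul_one,
      Real.norm_of_nonneg (by positivity)]
  have hmem : p ∈ closestPoints S (p + (ρ + ε) • u) := by
    rw [← hyeq]
    exact ⟨hp, le_antisymm (by rw [hyp', ← hxS]; exact hyS) hyp⟩
  have hcontra := (coe_le_projectionRange_iff hp (by positivity)).2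
    (mem_closestPoints_add_smul_iff.1 hmem).2
  rw [h] at hcontra
  have : ρ + ε ≤ ρ := by exact_mod_cast hcontra
  linarith

end

/-! ### Taylor estimate with Lipschitz derivative -/

section Taylor

variable {E G : Type*} [NormedAddCommGroup E] [NormedSpace ℝ E] [NormedAddCommGroup G]
  [NormedSpace ℝ G]

theorem norm_sub_fderiv_le_of_lipschitzWith {f : E → G} {L : ℝ≥0} (hf : Differentiable ℝ f)
    (hL : LipschitzWith L (fderiv ℝ f)) (x v : E) :
    ‖f (x + v) - f x - fderiv ℝ f x v‖ ≤ L / 2 * ‖v‖ ^ 2 := by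
  have hg : ∀ t : ℝ, HasDerivAt (fun t : ℝ => f (x + t • v) - f x - t • fderiv ℝ f x v)
      (fderiv ℝ f (x + t • v) v - fderiv ℝ f x v) t := by
    intro t
    have h1 : HasDerivAt (fun t : ℝ => x + t • v) v t := by
      simpa using ((hasDerivAt_id t).smul_const v).const_add x
    have h2 := (hf (x + t • v)).hasFDerivAt.comp_hasDerivAt t h1
    have h3 : HasDerivAt (fun t : ℝ => t • fderiv ℝ f x v) (fderiv ℝ f x v) t := by
      simpa using (hasDerivAt_id t).smul_const (fderiv ℝ f x v)
    exact (h2.sub_const (f x)).sub h3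
  have hB : ∀ t : ℝ, HasDerivAt (fun t : ℝ => L / 2 * ‖v‖ ^ 2 * t ^ 2) (L * ‖v‖ ^ 2 * t) t := by
    intro t
    have := (hasDerivAt_pow 2 t).const_mul (L / 2 * ‖v‖ ^ 2)
    refine this.congr_deriv ?_
    norm_num
    ring
  have key := image_norm_le_of_norm_deriv_right_le_deriv_boundary (a := 0) (b := 1)
    (fun t _ => (hg t).continuousAt.continuousWithinAt)
    (fun t _ => (hg t).hasDerivWithinAt) (by simp) hB (by
      intro t ht
      rw [← sub_apply]
      refine (ContinuousLinearMap.le_opNorm _ _).trans ?_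
      have h1 : ‖fderiv ℝ f (x + t • v) - fderiv ℝ f x‖ ≤ L * (t * ‖v‖) := by
        rw [← dist_eq_norm]
        refine (hL.dist_le_mul _ _).trans_eq ?_
        rw [dist_eq_norm, add_sub_cancel_left, norm_smul, Real.norm_of_nonneg ht.1]
      calc _ ≤ L * (t * ‖v‖) * ‖v‖ := by gcongr
        _ = _ := by ring)
  simpa using key (right_mem_Icc.2 zero_le_one)

end Taylor

/-! ### The bounding sphere -/

section

variable {d : ℕ} {S : Set (EuclideanSpace ℝ (Fin d))} {p u c o : EuclideanSpace ℝ (Fin d)}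
  {r : ℝ}

theorem subset_ball_of_isPreconnected {U : Set (EuclideanSpace ℝ (Fin d))}
    (hU : IsPreconnected U) (hdisj : Disjoint U (sphere o r)) (hne : (U ∩ ball o r).Nonempty) :
    U ⊆ ball o r := by
  intro x hx
  by_contra hxr
  obtain ⟨a, haU, ha⟩ := hne
  obtain ⟨z, hzU, hz⟩ := hU.intermediate_value haU hx (f := fun z => dist z o)
    (by fun_prop) ⟨(mem_ball.1 ha).le, not_lt.1 hxr⟩
  exact Set.disjoint_left.1 hdisj hzU hz

/-- A homeomorphism that preserves a sphere maps the ball it bounds into itself. -/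
theorem image_closedBall_subset {F : EuclideanSpace ℝ (Fin d) ≃ EuclideanSpace ℝ (Fin d)}
    (hF : Continuous F) (hFs : Continuous F.symm) (hsphere : F '' sphere o r = sphere o r) :
    F '' closedBall o r ⊆ closedBall o r := by
  rcases (closedBall o r).eq_empty_or_nonempty with he | hne
  · simp [he]
  obtain ⟨y, hy, hmax⟩ := (isCompact_closedBall o r).exists_isMaxOn hne
    (f := fun y => dist (F y) o) (by fun_prop)
  rintro _ ⟨z, hz, rfl⟩
  refine (hmax hz).trans (show dist (F y) o ≤ r from ?_)
  by_contra hlt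
  push Not at hlt
  have hyb : y ∈ ball o r := by
    refine lt_of_le_of_ne (mem_closedBall.1 hy) fun he => ?_
    have : F y ∈ sphere o r := hsphere ▸ mem_image_of_mem F he
    exact hlt.ne' this
  -- The farthest image point F(y) is pushed radially outwards; its preimage stays in the ball,
  -- contradicting maximality.
  have hev : ∀ᶠ t in 𝓝 (1 : ℝ), F.symm (o + t • (F y - o)) ∈ ball o r := by
    have : Continuous fun t : ℝ => F.symm (o + t • (F y - o)) := by fun_prop
    exact this.continuousAt.eventually_mem (isOpen_ball.mem_nhds (by simpa using hyb))
  obtain ⟨t, ht, ht1⟩ := ((hev.filter_mono nhdsWithin_le_nhds).and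
    (self_mem_nhdsWithin : Ioi (1 : ℝ) ∈ 𝓝[>] 1)).exists
  have h1 : dist (F (F.symm (o + t • (F y - o)))) o ≤ dist (F y) o := hmax (ball_subset_closedBall ht)
  rw [F.apply_symm_apply, dist_eq_norm, add_sub_cancel_left, norm_smul, ← dist_eq_norm,
    Real.norm_of_nonneg (by linarith)] at h1
  have h2 : 0 ≤ r := dist_nonneg.trans hy
  nlinarith

theorem image_ball_subset {F : EuclideanSpace ℝ (Fin d) ≃ EuclideanSpace ℝ (Fin d)}
    (hF : Continuous F) (hFs : Continuous F.symm) (hsphere : F '' sphere o r = sphere o r) :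
    F '' ball o r ⊆ ball o r := by
  rintro _ ⟨y, hy, rfl⟩
  refine lt_of_le_of_ne
    (mem_closedBall.1 (image_closedBall_subset hF hFs hsphere
      (mem_image_of_mem F (ball_subset_closedBall hy))))
    fun he => ?_
  have : F y ∈ F '' sphere o r := by rw [hsphere]; exact he
  exact (mem_ball.1 hy).ne ((F.injective.mem_set_image).1 this)

/-- The medial axis of a set lies in every open ball whose boundary belongs to the set and whose
closure contains the set. -/
theorem medialAxis_subset_ball (hr : 0 < r) (hSball : S ⊆ closedBall o r)
    (hsphere : sphere o r ⊆ S) : medialAxis S ⊆ ball o r := by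
  intro c hc
  by_contra hcr
  rw [mem_ball, not_lt] at hcr
  have hco : 0 < dist c o := hr.trans_le hcr
  obtain ⟨a, ha, b, hb, hab⟩ := hc
  set q := o + (r / dist c o) • (c - o) with hq
  have hqS : q ∈ S := by
    refine hsphere ?_
    rw [mem_sphere, hq, dist_eq_norm, add_sub_cancel_left, norm_smul, ← dist_eq_norm,
      Real.norm_of_nonneg (by positivity), div_mul_cancel₀ _ hco.ne']
  have hcq : dist c q = dist c o - r := by
    have : c - q = (1 - r / dist c o) • (c - o) := by rw [hq, sub_smul, one_smul]; abel
    have h0 : 0 ≤ 1 - r / dist c o := sub_nonneg.2 ((div_le_one hco).2 hcr)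
    rw [dist_eq_norm, this, norm_smul, Real.norm_of_nonneg h0, ← dist_eq_norm, sub_mul, one_mul,
      div_mul_cancel₀ _ hco.ne']
  have h1 : infDist c S ≤ dist c o - r := hcq ▸ infDist_le_dist_of_mem hqS
  -- The midpoint of two closest points is strictly closer to c than S is, yet it lies in the ball,
  -- no point of which is closer to c than q ∈ S.
  have hm : midpoint ℝ a b ∈ closedBall o r :=
    (convex_closedBall o r).midpoint_mem (hSball ha.1) (hSball hb.1)
  have h2 : dist c o - r ≤ dist c (midpoint ℝ a b) := by
    have := dist_triangle c (midpoint ℝ a b) o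
    rw [mem_closedBall] at hm
    linarith
  have h3 : dist c (midpoint ℝ a b) < infDist c S := by
    rw [← mem_ball']
    exact openSegment_subset_ball_of_ne (mem_closedBall'.2 ha.2.le) (mem_closedBall'.2 hb.2.le) hab
      (midpoint_mem_openSegment a b)
  linarith

/-- The radius of an empty ball that points into a ball bounded by a sphere of the set. -/
theorem IsEmptyBall.le_of_mem_ball {R t : ℝ} (h : IsEmptyBall S p u R) (hsphere : sphere o r ⊆ S)
    (hp : p ∈ closedBall o r) (hu : ‖u‖ = 1) (ht : 0 < t) (hpt : p + t • u ∈ ball o r) :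
    R ≤ r := by
  have hr : 0 < r := dist_nonneg.trans_lt hpt
  rw [mem_closedBall] at hp
  have htu : ∀ τ : ℝ, 0 ≤ τ → dist (p + τ • u) p = τ := fun τ hτ => by
    rw [dist_eq_norm, add_sub_cancel_left, norm_smul, hu, mul_one, Real.norm_of_nonneg hτ]
  have hfar : r ≤ dist (p + (t + 2 * r) • u) o := by
    have := dist_triangle (p + (t + 2 * r) • u) o p
    rw [htu _ (by positivity), dist_comm o p] at this
    linarith
  -- The ray meets the sphere at some τ ≤ 2r; emptiness tested at that point of S reads 2Rτ ≤ τ².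
  obtain ⟨τ, hτ, hτr⟩ := intermediate_value_Icc (show t ≤ t + 2 * r by linarith)
    (f := fun τ : ℝ => dist (p + τ • u) o) (by fun_prop) ⟨(mem_ball.1 hpt).le, hfar⟩
  have hτ0 : 0 < τ := ht.trans_le hτ.1
  have h1 := h _ (hsphere hτr)
  rw [add_sub_cancel_left, real_inner_smul_left, real_inner_self_eq_norm_sq, norm_smul, hu,
    Real.norm_of_nonneg hτ0.le] at h1
  have h2 : τ ≤ 2 * r := by
    have := dist_triangle (p + τ • u) o p
    rw [htu _ hτ0.le, dist_comm o p] at this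
    have h3 : dist (p + τ • u) o = r := hτr
    linarith
  nlinarith

end

/-! ### Transport of empty balls by the diffeomorphism -/

section

variable {d : ℕ} {S : Set (EuclideanSpace ℝ (Fin d))} {u c o : EuclideanSpace ℝ (Fin d)}
  {r : ℝ}

namespace IsC11Diffeo

variable {F : EuclideanSpace ℝ (Fin d) ≃ EuclideanSpace ℝ (Fin d)} {LF LDF : ℝ≥0}

theorem symm (hF : IsC11Diffeo F LF LDF) : IsC11Diffeo F.symm LF LDF :=
  ⟨hF.contDiff_symm, hF.contDiff, hF.lipschitz_symm, hF.lipschitz, hF.lipschitz_fderiv_symm,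
    hF.lipschitz_fderiv⟩

theorem differentiable (hF : IsC11Diffeo F LF LDF) : Differentiable ℝ F :=
  hF.contDiff.differentiable one_ne_zero

theorem fderiv_symm_comp (hF : IsC11Diffeo F LF LDF) (p : EuclideanSpace ℝ (Fin d)) :
    (fderiv ℝ F.symm (F p)) ∘L (fderiv ℝ F p) = .id ℝ _ := by
  rw [← fderiv_comp p (hF.symm.differentiable _) (hF.differentiable p), F.symm_comp_self,
    fderiv_id]

theorem fderiv_comp_symm (hF : IsC11Diffeo F LF LDF) (p : EuclideanSpace ℝ (Fin d)) :
    (fderiv ℝ F p) ∘L (fderiv ℝ F.symm (F p)) = .id ℝ _ := by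
  simpa using hF.symm.fderiv_symm_comp (F p)

theorem fderiv_symm_apply (hF : IsC11Diffeo F LF LDF) (p v : EuclideanSpace ℝ (Fin d)) :
    fderiv ℝ F.symm (F p) (fderiv ℝ F p v) = v :=
  congrArg (fun A => A v) (hF.fderiv_symm_comp p)

theorem fderiv_apply_symm (hF : IsC11Diffeo F LF LDF) (p v : EuclideanSpace ℝ (Fin d)) :
    fderiv ℝ F p (fderiv ℝ F.symm (F p) v) = v :=
  congrArg (fun A => A v) (hF.fderiv_comp_symm p)

theorem norm_fderiv_le (hF : IsC11Diffeo F LF LDF) (p : EuclideanSpace ℝ (Fin d)) :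
    ‖fderiv ℝ F p‖ ≤ LF :=
  norm_fderiv_le_of_lipschitz ℝ hF.lipschitz

theorem one_le (hF : IsC11Diffeo F LF LDF) (hu : ‖u‖ = 1) : (1 : ℝ) ≤ LF := by
  have h1 : dist (F.symm (F u)) (F.symm (F 0)) ≤ LF * (LF * dist u 0) :=
    (hF.lipschitz_symm.dist_le_mul _ _).trans (by
      gcongr
      exact hF.lipschitz.dist_le_mul _ _)
  rw [F.symm_apply_apply, F.symm_apply_apply, dist_zero_right, hu, mul_one] at h1
  by_contra hlt
  nlinarith [LF.coe_nonneg]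

theorem inverse_adjoint (hF : IsC11Diffeo F LF LDF) (p : EuclideanSpace ℝ (Fin d)) :
    (ContinuousLinearMap.adjoint (fderiv ℝ F p)).inverse =
      ContinuousLinearMap.adjoint (fderiv ℝ F.symm (F p)) := by
  refine ContinuousLinearMap.inverse_eq ?_ ?_
  · rw [← ContinuousLinearMap.adjoint_comp, hF.fderiv_symm_comp, ContinuousLinearMap.adjoint_id]
  · rw [← ContinuousLinearMap.adjoint_comp, hF.fderiv_comp_symm, ContinuousLinearMap.adjoint_id]

theorem adjoint_apply_inverse (hF : IsC11Diffeo F LF LDF) (p v : EuclideanSpace ℝ (Fin d)) :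
    ContinuousLinearMap.adjoint (fderiv ℝ F p)
      ((ContinuousLinearMap.adjoint (fderiv ℝ F p)).inverse v) = v := by
  rw [hF.inverse_adjoint, ← ContinuousLinearMap.comp_apply, ← ContinuousLinearMap.adjoint_comp,
    hF.fderiv_symm_comp, ContinuousLinearMap.adjoint_id, ContinuousLinearMap.id_apply]

theorem one_le_mul_norm_inverse (hF : IsC11Diffeo F LF LDF) (p : EuclideanSpace ℝ (Fin d))
    (hu : ‖u‖ = 1) : 1 ≤ LF * ‖(ContinuousLinearMap.adjoint (fderiv ℝ F p)).inverse u‖ := by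
  rw [← hu]
  conv_lhs => rw [← hF.adjoint_apply_inverse p u]
  refine (ContinuousLinearMap.le_opNorm _ _).trans ?_
  rw [LinearIsometryEquiv.norm_map]
  gcongr
  exact hF.norm_fderiv_le p

theorem norm_inverse_pos (hF : IsC11Diffeo F LF LDF) (p : EuclideanSpace ℝ (Fin d))
    (hu : ‖u‖ = 1) : 0 < ‖(ContinuousLinearMap.adjoint (fderiv ℝ F p)).inverse u‖ :=
  pos_of_mul_pos_right (zero_lt_one.trans_le (hF.one_le_mul_norm_inverse p hu)) LF.coe_nonneg

theorem norm_imageNormal (hF : IsC11Diffeo F LF LDF) (p : EuclideanSpace ℝ (Fin d))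
    (hu : ‖u‖ = 1) : ‖imageNormal F p u‖ = 1 := by
  rw [imageNormal, norm_smul, norm_inv, norm_norm,
    inv_mul_cancel₀ (hF.norm_inverse_pos p hu).ne']

theorem norm_smul_imageNormal (hF : IsC11Diffeo F LF LDF) (p : EuclideanSpace ℝ (Fin d))
    (hu : ‖u‖ = 1) :
    ‖(ContinuousLinearMap.adjoint (fderiv ℝ F p)).inverse u‖ • imageNormal F p u =
      (ContinuousLinearMap.adjoint (fderiv ℝ F p)).inverse u := by
  rw [imageNormal, smul_smul, mul_inv_cancel₀ (hF.norm_inverse_pos p hu).ne', one_smul]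

theorem inner_fderiv_symm (hF : IsC11Diffeo F LF LDF) (p w : EuclideanSpace ℝ (Fin d))
    (hu : ‖u‖ = 1) :
    ⟪fderiv ℝ F.symm (F p) w, u⟫_ℝ =
      ‖(ContinuousLinearMap.adjoint (fderiv ℝ F p)).inverse u‖ * ⟪w, imageNormal F p u⟫_ℝ := by
  rw [← real_inner_smul_right, hF.norm_smul_imageNormal p hu, hF.inverse_adjoint,
    ContinuousLinearMap.adjoint_inner_right]

/-- This symmetry lets every estimate for F be reused for F⁻¹ at (F(p), u'). -/
theorem imageNormal_symm (hF : IsC11Diffeo F LF LDF) (p : EuclideanSpace ℝ (Fin d))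
    (hu : ‖u‖ = 1) : imageNormal F.symm (F p) (imageNormal F p u) = u := by
  have h1 : (ContinuousLinearMap.adjoint (fderiv ℝ F.symm (F p))).inverse (imageNormal F p u) =
      ‖(ContinuousLinearMap.adjoint (fderiv ℝ F p)).inverse u‖⁻¹ • u := by
    rw [hF.symm.inverse_adjoint, F.symm_symm, F.symm_apply_apply, imageNormal, map_smul,
      hF.adjoint_apply_inverse]
  have h2 := hF.norm_inverse_pos p hu
  rw [imageNormal, h1, norm_smul, norm_inv, norm_norm, hu, mul_one, inv_inv, smul_smul,
    mul_inv_cancel₀ h2.ne', one_smul]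

theorem map_orthogonal (hF : IsC11Diffeo F LF LDF) (p : EuclideanSpace ℝ (Fin d))
    (hu : ‖u‖ = 1) :
    Submodule.map (fderiv ℝ F p).toLinearMap (ℝ ∙ u)ᗮ = (ℝ ∙ imageNormal F p u)ᗮ := by
  ext w
  simp only [Submodule.mem_map, Submodule.mem_orthogonal_singleton_iff_inner_left,
    ContinuousLinearMap.coe_coe]
  constructor
  · rintro ⟨v, hv, rfl⟩
    rw [← hF.fderiv_symm_apply p v, hF.inner_fderiv_symm p _ hu] at hv
    exact (mul_eq_zero.1 hv).resolve_left (hF.norm_inverse_pos p hu).ne'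
  · intro hw
    exact ⟨_, by rw [hF.inner_fderiv_symm p w hu, hw, mul_zero], hF.fderiv_apply_symm p w⟩

/-- Taylor's formula for F⁻¹ at F(p), paired with u; the adjoint moves the linear term onto u'. -/
theorem le_inner_symm_sub (hF : IsC11Diffeo F LF LDF) (p w : EuclideanSpace ℝ (Fin d))
    (hu : ‖u‖ = 1) :
    ‖(ContinuousLinearMap.adjoint (fderiv ℝ F p)).inverse u‖ * ⟪w, imageNormal F p u⟫_ℝ
      - LDF / 2 * ‖w‖ ^ 2 ≤ ⟪F.symm (F p + w) - p, u⟫_ℝ := by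
  have h1 := norm_sub_fderiv_le_of_lipschitzWith hF.symm.differentiable
    hF.lipschitz_fderiv_symm (F p) w
  rw [F.symm_apply_apply] at h1
  have h2 := (abs_le.1 (abs_real_inner_le_norm
    (F.symm (F p + w) - p - fderiv ℝ F.symm (F p) w) u)).1
  rw [hu, mul_one, inner_sub_left, hF.inner_fderiv_symm p w hu] at h2
  linarith

theorem norm_symm_sub_le (hF : IsC11Diffeo F LF LDF) (p w : EuclideanSpace ℝ (Fin d)) :
    ‖F.symm (F p + w) - p‖ ≤ LF * ‖w‖ := by
  have := hF.lipschitz_symm.dist_le_mul (F p + w) (F p)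
  rwa [F.symm_apply_apply, dist_eq_norm, dist_eq_norm, add_sub_cancel_left] at this

/-- The image normal points into the image of the ball. -/
theorem eventually_mem_image_ball (hF : IsC11Diffeo F LF LDF) (p : EuclideanSpace ℝ (Fin d))
    (hu : ‖u‖ = 1) {ρ : ℝ} (hρ : 0 < ρ) :
    ∀ᶠ t : ℝ in 𝓝[>] 0, F p + t • imageNormal F p u ∈ F '' ball (p + ρ • u) ρ := by
  have hb := hF.norm_inverse_pos p hu
  set b := ‖(ContinuousLinearMap.adjoint (fderiv ℝ F p)).inverse u‖ with hb_def
  have hK : 0 < (LF : ℝ) ^ 2 + ρ * LDF := by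
    have := hF.one_le hu
    positivity
  -- Below this threshold the linear term 2ρbt exceeds the quadratic terms (L_F² + ρL_DF)t².
  filter_upwards [Ioo_mem_nhdsGT
    (show 0 < 2 * ρ * b / ((LF : ℝ) ^ 2 + ρ * LDF) by positivity)] with t ht
  refine ⟨F.symm (F p + t • imageNormal F p u), ?_, F.apply_symm_apply _⟩
  have hu' := hF.norm_imageNormal p hu
  have hw : ‖t • imageNormal F p u‖ = t := by
    rw [norm_smul, hu', mul_one, Real.norm_of_nonneg ht.1.le]
  have h1 := hF.le_inner_symm_sub p (t • imageNormal F p u) hu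
  have h2 := hF.norm_symm_sub_le p (t • imageNormal F p u)
  rw [hw] at h2
  rw [hw, real_inner_smul_left, real_inner_self_eq_norm_sq, hu', ← hb_def] at h1
  set z := F.symm (F p + t • imageNormal F p u)
  have h3 := (lt_div_iff₀ hK).1 ht.2
  have h4 : ‖z - p‖ ^ 2 < 2 * ρ * ⟪z - p, u⟫_ℝ := by
    have h5 : ‖z - p‖ ^ 2 ≤ (LF * t) ^ 2 := by gcongr
    have h6 : 2 * ρ * (b * (t * 1 ^ 2) - LDF / 2 * t ^ 2) ≤ 2 * ρ * ⟪z - p, u⟫_ℝ := by gcongr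
    have h7 := mul_lt_mul_of_pos_left h3 ht.1
    nlinarith
  rw [← not_le, ← dist_add_smul_le_iff, not_le] at h4
  rw [mem_ball']
  refine h4.trans_eq ?_
  rw [dist_eq_norm, add_sub_cancel_left, norm_smul, hu, mul_one, Real.norm_of_nonneg hρ.le]

/-- The image of an empty ball contains an empty ball with the image normal. -/
theorem isEmptyBall_image (hF : IsC11Diffeo F LF LDF) {p : EuclideanSpace ℝ (Fin d)}
    (hu : ‖u‖ = 1) {ρ : ℝ} (hρ : 0 < ρ) (h : IsEmptyBall S p u ρ) :
    IsEmptyBall (F '' S) (F p) (imageNormal F p u)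
      (ρ / ((LF : ℝ) ^ 3 + ρ * LDF * LF ^ 2)) := by
  rintro _ ⟨s, hs, rfl⟩
  have hLF := hF.one_le hu
  have hK : 0 < (LF : ℝ) ^ 3 + ρ * LDF * LF ^ 2 := by positivity
  obtain ⟨w, hw⟩ : ∃ w, w = F s - F p := ⟨_, rfl⟩
  have hsw : F.symm (F p + w) = s := by rw [hw, add_sub_cancel, F.symm_apply_apply]
  rw [← hw]
  rcases le_or_gt ⟪w, imageNormal F p u⟫_ℝ 0 with hi | hi
  · exact (mul_nonpos_of_nonneg_of_nonpos (by positivity) hi).trans (by positivity)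
  have h1 := hF.le_inner_symm_sub p w hu
  have h2 := hF.norm_symm_sub_le p w
  have h0 := hF.one_le_mul_norm_inverse p hu
  rw [hsw] at h1 h2
  set b := ‖(ContinuousLinearMap.adjoint (fderiv ℝ F p)).inverse u‖
  set i := ⟪w, imageNormal F p u⟫_ℝ
  have h3 : 2 * ρ * ⟪s - p, u⟫_ℝ ≤ (LF * ‖w‖) ^ 2 := (h s hs).trans (by gcongr)
  have h4 : 2 * ρ * (b * i - LDF / 2 * ‖w‖ ^ 2) ≤ 2 * ρ * ⟪s - p, u⟫_ℝ := by gcongr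
  -- The unknown factor b is removed by L_F b ≥ 1, at the price of one more power of L_F.
  have h5 : 2 * ρ * i * 1 ≤ 2 * ρ * i * (LF * b) := by gcongr
  have h6 : LF * (2 * ρ * (b * i)) ≤ LF * ((LF ^ 2 + ρ * LDF) * ‖w‖ ^ 2) :=
    mul_le_mul_of_nonneg_left (by linarith) LF.coe_nonneg
  have h7 : ρ * LDF * LF * ‖w‖ ^ 2 ≤ ρ * LDF * LF ^ 2 * ‖w‖ ^ 2 := by
    have : (LF : ℝ) ≤ LF ^ 2 := by nlinarith
    gcongr
  have h8 : 2 * ρ * i ≤ ‖w‖ ^ 2 * (LF ^ 3 + ρ * LDF * LF ^ 2) := by linarith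
  calc 2 * (ρ / (LF ^ 3 + ρ * LDF * LF ^ 2)) * i
      = 2 * ρ * i / (LF ^ 3 + ρ * LDF * LF ^ 2) := by ring
    _ ≤ ‖w‖ ^ 2 := (div_le_iff₀ hK).2 h8

/-- The angle between a unit vector and its image normal. -/
theorem sqrt_le_inner_imageNormal (hF : IsC11Diffeo F LF LDF) {p : EuclideanSpace ℝ (Fin d)}
    (hu : ‖u‖ = 1) {ε : ℝ} (hε1 : ε < 1)
    (hε : ‖fderiv ℝ F p - ContinuousLinearMap.id ℝ (EuclideanSpace ℝ (Fin d))‖ ≤ ε) :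
    √(1 - ε ^ 2) ≤ ⟪u, imageNormal F p u⟫_ℝ := by
  have hε0 : 0 ≤ ε := (norm_nonneg _).trans hε
  have hb := hF.norm_inverse_pos p hu
  have hbv := hF.norm_smul_imageNormal p hu
  have hAv := hF.adjoint_apply_inverse p u
  set v := (ContinuousLinearMap.adjoint (fderiv ℝ F p)).inverse u
  have h1 : ‖u - v‖ ≤ ε * ‖v‖ := by
    have h2 : u - v = ContinuousLinearMap.adjoint
        (fderiv ℝ F p - ContinuousLinearMap.id ℝ (EuclideanSpace ℝ (Fin d))) v := by
      rw [map_sub, ContinuousLinearMap.adjoint_id, sub_apply, hAv, ContinuousLinearMap.id_apply]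
    rw [h2]
    refine (ContinuousLinearMap.le_opNorm _ _).trans ?_
    rw [LinearIsometryEquiv.norm_map]
    gcongr
  have h3 : ‖u - v‖ ^ 2 ≤ (ε * ‖v‖) ^ 2 := by gcongr
  rw [norm_sub_sq_real, hu] at h3
  have h4 : ‖v‖ * ⟪u, imageNormal F p u⟫_ℝ = ⟪u, v⟫_ℝ := by
    rw [← real_inner_smul_right, hbv]
  have h5 : 0 ≤ 1 - ε ^ 2 := by nlinarith
  have h6 := Real.sq_sqrt h5
  -- From `h3`, 2⟨u, v⟩ ≥ 1 + (1 − ε²)|v|², and this is at least 2√(1 − ε²)|v| by the inequality of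
  -- means.
  have h7 : ‖v‖ * √(1 - ε ^ 2) ≤ ‖v‖ * ⟪u, imageNormal F p u⟫_ℝ := by
    rw [h4]
    nlinarith [sq_nonneg (1 - ‖v‖ * √(1 - ε ^ 2))]
  exact le_of_mul_le_mul_left h7 hb

end IsC11Diffeo

end

/-! ### Radius bounds and displacement of the centres -/

section

variable {d : ℕ} {S : Set (EuclideanSpace ℝ (Fin d))} {p u o : EuclideanSpace ℝ (Fin d)}
  {r : ℝ}

theorem ball_subset_of_isEmptyBall {ρ : ℝ} (hsphere : sphere o r ⊆ S) (hu : ‖u‖ = 1)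
    (hρ : 0 < ρ) (h : IsEmptyBall S p u ρ) (hc : p + ρ • u ∈ ball o r) :
    ball (p + ρ • u) ρ ⊆ ball o r := by
  refine subset_ball_of_isPreconnected (convex_ball _ _).isPreconnected
    (Set.disjoint_left.2 fun z hz hzs => ?_) ⟨_, mem_ball_self hρ, hc⟩
  have h1 := dist_add_smul_le_iff.2 (h z (hsphere hzs))
  rw [dist_eq_norm (p + ρ • u) p, add_sub_cancel_left, norm_smul, hu, mul_one,
    Real.norm_of_nonneg hρ.le] at h1
  exact (mem_ball'.1 hz).not_ge h1

/-- The maximal empty ball of the image, with the bounds on its radius. -/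
theorem exists_projectionRange_image (hSball : S ⊆ closedBall o r) (hsphere : sphere o r ⊆ S)
    {F : EuclideanSpace ℝ (Fin d) ≃ EuclideanSpace ℝ (Fin d)} {LF LDF : ℝ≥0}
    (hF : IsC11Diffeo F LF LDF) (hFsphere : F '' sphere o r = sphere o r) (hp : p ∈ S)
    (hu : ‖u‖ = 1) {ρ : ℝ} (hρ : 0 < ρ) (h : projectionRange S p u = ρ)
    (hc : p + ρ • u ∈ ball o r) :
    ∃ ρ' : ℝ, projectionRange (F '' S) (F p) (imageNormal F p u) = ρ' ∧ 0 < ρ' ∧ ρ' ≤ r ∧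
      ρ / ((LF : ℝ) ^ 3 + ρ * LDF * LF ^ 2) ≤ ρ' ∧
      (ρ * LDF * LF ^ 2 < 1 → ρ' ≤ (LF : ℝ) ^ 3 * ρ / (1 - ρ * LDF * LF ^ 2)) := by
  have hE := (coe_le_projectionRange_iff hp hρ).1 h.ge
  have hLF := hF.one_le hu
  have hu' := hF.norm_imageNormal p hu
  have hR₀ : 0 < ρ / ((LF : ℝ) ^ 3 + ρ * LDF * LF ^ 2) := by positivity
  have hcF := hF.differentiable.continuous
  have hcFs := hF.symm.differentiable.continuous
  have hFp : F p ∈ closedBall o r :=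
    image_closedBall_subset hcF hcFs hFsphere (mem_image_of_mem F (hSball hp))
  have hsphere' : sphere o r ⊆ F '' S := hFsphere ▸ image_mono hsphere
  obtain ⟨t, ht, ht0⟩ := ((hF.eventually_mem_image_ball p hu hρ).and self_mem_nhdsWithin).exists
  have htr : F p + t • imageNormal F p u ∈ ball o r :=
    image_ball_subset hcF hcFs hFsphere
      (image_mono (ball_subset_of_isEmptyBall hsphere hu hρ hE hc) ht)
  obtain ⟨ρ', h1, h2, h3, h4⟩ := exists_projectionRange_eq (mem_image_of_mem F hp) hR₀
    (hF.isEmptyBall_image hu hρ hE) fun R _ hR => hR.le_of_mem_ball hsphere' hFp hu' ht0 htr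
  have hρ' := hR₀.trans_le h2
  refine ⟨ρ', h1, hρ', h3, h2, fun hlt => ?_⟩
  -- The lower bound for F⁻¹, applied to the new ball, gives ρ'/(L_F³ + ρ'L_DF L_F²) ≤ ρ; solving
  -- for ρ' gives the upper bound.
  have h5 := hF.symm.isEmptyBall_image hu' hρ' h4
  rw [F.symm_apply_apply, hF.imageNormal_symm p hu, F.symm_image_image,
    ← coe_le_projectionRange_iff hp (by positivity), h, EReal.coe_le_coe_iff,
    div_le_iff₀ (by positivity)] at h5
  rw [le_div_iff₀ (by linarith)]
  linarith

theorem norm_smul_sub_smul_le {ρ ρ' M k : ℝ} {u u' : EuclideanSpace ℝ (Fin d)} (hu : ‖u‖ = 1)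
    (hu' : ‖u'‖ = 1) (hρ : 0 < ρ) (hρ' : 0 < ρ') (hρr : ρ ≤ r) (hρr' : ρ' ≤ r) (hM : 1 ≤ M)
    (h1 : ρ ≤ M * ρ') (h2 : ρ' ≤ M * ρ) (hk1 : k ≤ 1) (hk : k ≤ ⟪u, u'⟫_ℝ) :
    ‖ρ • u - ρ' • u'‖ ≤ r * √(1 + M ^ 2 - 2 * M * k) := by
  have hX : 0 ≤ 1 + M ^ 2 - 2 * M * k := by nlinarith [sq_nonneg (1 - M)]
  have key : ∀ a b : ℝ, 0 < a → a ≤ b → a ≤ r → b ≤ M * a →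
      a ^ 2 + b ^ 2 - 2 * a * b * k ≤ r ^ 2 * (1 + M ^ 2 - 2 * M * k) := by
    intro a b ha hab har hb
    -- With a the smaller radius, this product is the increase of a² + b² − 2abk when b is replaced
    -- by Ma.
    have h3 : 0 ≤ (M * a - b) * (M * a + b - 2 * a * k) :=
      mul_nonneg (by linarith) (by nlinarith)
    have h4 : a ^ 2 * (1 + M ^ 2 - 2 * M * k) ≤ r ^ 2 * (1 + M ^ 2 - 2 * M * k) := by gcongr
    nlinarith
  have h5 : ρ ^ 2 + ρ' ^ 2 - 2 * ρ * ρ' * k ≤ r ^ 2 * (1 + M ^ 2 - 2 * M * k) := by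
    rcases le_total ρ ρ' with h | h
    · exact key ρ ρ' hρ h hρr h2
    · linarith [key ρ' ρ hρ' h hρr' h1]
  have h6 := norm_sub_sq_real (ρ • u) (ρ' • u')
  rw [real_inner_smul_left, real_inner_smul_right, norm_smul, norm_smul, hu, hu', mul_one, mul_one,
    Real.norm_of_nonneg hρ.le, Real.norm_of_nonneg hρ'.le] at h6
  have h7 : ρ * (ρ' * k) ≤ ρ * (ρ' * ⟪u, u'⟫_ℝ) := by gcongr
  refine abs_le_of_sq_le_sq' ?_ (by have := hρ.trans_le hρr; positivity) |>.2
  rw [mul_pow, Real.sq_sqrt hX]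
  linarith

theorem radius_ratio_le {ρ ρ' L D : ℝ} (hρ : 0 < ρ) (hρ' : 0 < ρ') (hL : 1 ≤ L) (hD : 0 ≤ D)
    (hρr : ρ ≤ r) (hr : r * D * L ^ 2 ≤ 1 / 2)
    (h1 : ρ / (L ^ 3 + ρ * D * L ^ 2) ≤ ρ')
    (h2 : ρ * D * L ^ 2 < 1 → ρ' ≤ L ^ 3 * ρ / (1 - ρ * D * L ^ 2)) :
    ρ ≤ L ^ 3 * (1 + 4 * r * D * L ^ 2) * ρ' ∧ ρ' ≤ L ^ 3 * (1 + 4 * r * D * L ^ 2) * ρ := by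
  have hy : ρ * D * L ^ 2 ≤ r * D * L ^ 2 := by gcongr
  have hy0 : 0 ≤ ρ * D * L ^ 2 := by positivity
  have hL3 : 1 ≤ L ^ 3 := one_le_pow₀ hL
  have h2' := h2 (by linarith)
  rw [div_le_iff₀ (by positivity)] at h1
  rw [le_div_iff₀ (by linarith)] at h2'
  have hx : 4 * r * D * L ^ 2 = 4 * (r * D * L ^ 2) := by ring
  rw [hx]
  set x := r * D * L ^ 2
  set y := ρ * D * L ^ 2
  constructor
  · refine h1.trans ?_
    rw [mul_comm]
    gcongr
    nlinarith
  · have h3 : ρ' ≤ ρ' * ((1 - y) * (1 + 2 * y)) := by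
      refine le_mul_of_one_le_right hρ'.le ?_
      nlinarith
    calc ρ' ≤ ρ' * (1 - y) * (1 + 2 * y) := by linarith
      _ ≤ L ^ 3 * ρ * (1 + 2 * y) := by gcongr
      _ ≤ L ^ 3 * ρ * (1 + 4 * x) := by gcongr; linarith
      _ = _ := by ring

theorem norm_add_smul_sub_le_distortionBound {ρ ρ' ε₁ ε₂ : ℝ} {LF LDF : ℝ≥0}
    {F : EuclideanSpace ℝ (Fin d) ≃ EuclideanSpace ℝ (Fin d)} (hF : IsC11Diffeo F LF LDF)
    (hε₁ : ‖F p - p‖ ≤ ε₁)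
    (hε₂ : ‖fderiv ℝ F p - ContinuousLinearMap.id ℝ (EuclideanSpace ℝ (Fin d))‖ ≤ ε₂)
    (hε : ε₂ < 1) (hu : ‖u‖ = 1) (hρ : 0 < ρ) (hρ' : 0 < ρ')
    (hρr : ρ ≤ r) (hρr' : ρ' ≤ r)
    (h1 : ρ ≤ (LF : ℝ) ^ 3 * (1 + 4 * r * LDF * LF ^ 2) * ρ')
    (h2 : ρ' ≤ (LF : ℝ) ^ 3 * (1 + 4 * r * LDF * LF ^ 2) * ρ) :
    ‖p + ρ • u - (F p + ρ' • imageNormal F p u)‖ ≤ distortionBound r LF LDF ε₁ ε₂ := by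
  have hr0 : 0 < r := hρ.trans_le hρr
  have hM : 1 ≤ (LF : ℝ) ^ 3 * (1 + 4 * r * LDF * LF ^ 2) :=
    one_le_mul_of_one_le_of_one_le (one_le_pow₀ (hF.one_le hu))
      (le_add_of_nonneg_right (by positivity))
  have h3 := norm_smul_sub_smul_le hu (hF.norm_imageNormal p hu) hρ hρ' hρr hρr' hM h1 h2
    (Real.sqrt_le_one.2 (sub_le_self 1 (sq_nonneg ε₂))) (hF.sqrt_le_inner_imageNormal hu hε hε₂)
  have h4 : p + ρ • u - (F p + ρ' • imageNormal F p u) =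
      (ρ • u - ρ' • imageNormal F p u) - (F p - p) := by abel
  rw [h4, distortionBound]
  refine (norm_sub_le _ _).trans (add_le_add (h3.trans ?_) hε₁)
  have h5 : 1 + ((LF : ℝ) ^ 3 * (1 + 4 * r * LDF * LF ^ 2)) ^ 2
      - 2 * (LF ^ 3 * (1 + 4 * r * LDF * LF ^ 2)) * √(1 - ε₂ ^ 2) =
      1 + LF ^ 6 * (1 + 4 * r * LDF * LF ^ 2) ^ 2
        - 2 * LF ^ 3 * (1 + 4 * r * LDF * LF ^ 2) * √(1 - ε₂ ^ 2) := by ring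
  rw [h5]
  -- The law of cosines gives the factor r; the 2r of the bound is slack.
  gcongr
  linarith

theorem infEDist_le_ofReal_of_mem_closure {x y : EuclideanSpace ℝ (Fin d)} {B : ℝ}
    {A : Set (EuclideanSpace ℝ (Fin d))} (hy : y ∈ closure A) (h : ‖x - y‖ ≤ B) :
    infEDist x A ≤ ENNReal.ofReal B := by
  rw [← infEDist_closure]
  refine (infEDist_le_edist_of_mem hy).trans ?_
  rw [edist_dist, dist_eq_norm]
  exact ENNReal.ofReal_le_ofReal h

end

/-! ### The main theorem -/

theorem mainTheorem1 {d : ℕ} (S : Set (EuclideanSpace ℝ (Fin d))) (hS : IsClosed S)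
    (o : EuclideanSpace ℝ (Fin d)) (r : ℝ) (hr : 0 < r)
    (hSball : S ⊆ closedBall o r) (hsphere : sphere o r ⊆ S)
    (F : EuclideanSpace ℝ (Fin d) ≃ EuclideanSpace ℝ (Fin d)) (LF LDF : ℝ≥0)
    (hF : IsC11Diffeo F LF LDF) (hFsphere : F '' sphere o r = sphere o r) :
    -- existence of the maximal empty ball of the image, and the bounds on its radius
    (∀ c ∈ medialAxis S, ∀ p ∈ closestPoints S c, ∀ (ρ : ℝ) (u u' : EuclideanSpace ℝ (Fin d)),
      ρ = ‖c - p‖ → u = ‖c - p‖⁻¹ • (c - p) → u' = imageNormal F p u →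
        IsMaximalEmptyBall S p u c ρ ∧
        -- `u'` is the unit vector orthogonal to `D_pF(T)`, where `T = uᗮ`, that points inside
        -- the image of the ball
        ‖u'‖ = 1 ∧
        Submodule.map (fderiv ℝ F p).toLinearMap (ℝ ∙ u)ᗮ = (ℝ ∙ u')ᗮ ∧
        (∀ᶠ t : ℝ in 𝓝[>] 0, F p + t • u' ∈ F '' ball c ρ) ∧
        ∃ (c' : EuclideanSpace ℝ (Fin d)) (ρ' : ℝ),
          IsMaximalEmptyBall (F '' S) (F p) u' c' ρ' ∧
          -- tangency to the affine hyperplane `F(p) + D_pF(T)`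
          closedBall c' ρ' ∩ ((fun v => F p + fderiv ℝ F p v) '' ((ℝ ∙ u)ᗮ : Set _)) = {F p} ∧
          ρ / ((LF : ℝ) ^ 3 + ρ * LDF * LF ^ 2) ≤ ρ' ∧
          (ρ * LDF * LF ^ 2 < 1 → ρ' ≤ (LF : ℝ) ^ 3 * ρ / (1 - ρ * LDF * LF ^ 2))) ∧
    -- the distance estimates
    (∀ ε₁ ε₂ : ℝ, (∀ x, ‖F x - x‖ ≤ ε₁) →
      (∀ x, ‖fderiv ℝ F x - ContinuousLinearMap.id ℝ (EuclideanSpace ℝ (Fin d))‖ ≤ ε₂) →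
      ε₂ < 1 → r * LDF * LF ^ 2 ≤ 1 / 2 →
        (∀ c ∈ medialAxis S, ∀ p ∈ closestPoints S c, ∀ u u' : EuclideanSpace ℝ (Fin d),
          u = ‖c - p‖⁻¹ • (c - p) → u' = imageNormal F p u →
            ‖axisProjection S p u - axisProjection (F '' S) (F p) u'‖
              ≤ distortionBound r LF LDF ε₁ ε₂) ∧
        hausdorffEDist (medialAxis S) (medialAxis (F '' S))
          ≤ ENNReal.ofReal (distortionBound r LF LDF ε₁ ε₂) ∧
        hausdorffEDist (closure (medialAxis S)) (closure (medialAxis (F '' S)))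
          ≤ ENNReal.ofReal (distortionBound r LF LDF ε₁ ε₂)) := by
  have hcF := hF.differentiable.continuous
  have hcFs := hF.symm.differentiable.continuous
  have hFS : IsClosed (F '' S) := by
    rw [F.image_eq_preimage_symm]
    exact hS.preimage hcFs
  have hFSball : F '' S ⊆ closedBall o r :=
    (image_mono hSball).trans (image_closedBall_subset hcF hcFs hFsphere)
  have hFSsphere : sphere o r ⊆ F '' S := hFsphere ▸ image_mono hsphere
  have hFsphere' : F.symm '' sphere o r = sphere o r := by
    conv_lhs => rw [← hFsphere]
    exact F.symm_image_image _
  refine ⟨?_, ?_⟩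
  · rintro c hc p hp ρ u u' rfl rfl rfl
    obtain ⟨hρ, hu, hcp, hrange⟩ := projectionRange_of_mem_medialAxis hc hp
    have hcball := medialAxis_subset_ball hr hSball hsphere hc
    rw [hcp] at hcball
    obtain ⟨ρ', h1, h2, h3, h4, h5⟩ := exists_projectionRange_image hSball hsphere hF hFsphere hp.1
      hu hρ hrange hcball
    have hmax := isMaximalEmptyBall_of_projectionRange_eq hp.1 hu hρ hrange
    have hev := hF.eventually_mem_image_ball p hu hρ
    rw [← hcp] at hmax hev
    refine ⟨hmax, hF.norm_imageNormal p hu, hF.map_orthogonal p hu, hev, _, ρ',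
      isMaximalEmptyBall_of_projectionRange_eq (mem_image_of_mem F hp.1)
        (hF.norm_imageNormal p hu) h2 h1, ?_, h4, h5⟩
    have ht := closedBall_inter_hyperplane (p := F p) (hF.norm_imageNormal p hu) h2.le
    rwa [← hF.map_orthogonal p hu, Submodule.map_coe, image_image] at ht
  intro ε₁ ε₂ hε₁ hε₂ hε hrL
  have main : ∀ c ∈ medialAxis S, ∀ p ∈ closestPoints S c,
      ‖axisProjection S p (‖c - p‖⁻¹ • (c - p)) -
          axisProjection (F '' S) (F p) (imageNormal F p (‖c - p‖⁻¹ • (c - p)))‖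
        ≤ distortionBound r LF LDF ε₁ ε₂ ∧
      axisProjection S p (‖c - p‖⁻¹ • (c - p)) = c ∧
      axisProjection (F '' S) (F p) (imageNormal F p (‖c - p‖⁻¹ • (c - p))) ∈
        closure (medialAxis (F '' S)) := by
    intro c hc p hp
    obtain ⟨hρ, hu, hcp, hrange⟩ := projectionRange_of_mem_medialAxis hc hp
    have hcball := medialAxis_subset_ball hr hSball hsphere hc
    rw [hcp] at hcball
    obtain ⟨ρ', h1, h2, h3, h4, h5⟩ := exists_projectionRange_image hSball hsphere hF hFsphere hp.1
      hu hρ hrange hcball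
    have hρr := ((coe_le_projectionRange_iff hp.1 hρ).1 hrange.ge).le_of_mem_ball hsphere
      (hSball hp.1) hu hρ hcball
    obtain ⟨h6, h7⟩ := radius_ratio_le hρ h2 (hF.one_le hu) LDF.coe_nonneg hρr hrL h4 h5
    rw [axisProjection, axisProjection, hrange, h1, EReal.toReal_coe, EReal.toReal_coe]
    exact ⟨norm_add_smul_sub_le_distortionBound hF (hε₁ p) (hε₂ p) hε hu hρ h2 hρr h3 h6 h7,
      hcp.symm, add_smul_mem_closure_medialAxis hFS (mem_image_of_mem F hp.1)
        (hF.norm_imageNormal p hu) h2 h1⟩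
  have hH : hausdorffEDist (medialAxis S) (medialAxis (F '' S))
      ≤ ENNReal.ofReal (distortionBound r LF LDF ε₁ ε₂) := by
    refine hausdorffEDist_le_of_infEDist (fun c hc => ?_) (fun c' hc' => ?_)
    · obtain ⟨p, hp⟩ := hc.nonempty
      obtain ⟨h1, h2, h3⟩ := main c hc p hp
      rw [h2] at h1
      exact infEDist_le_ofReal_of_mem_closure h3 h1
    -- The ball at c' is pulled back by F⁻¹ for the radius bounds, but the displacement is estimated
    -- with F at p, where ε₁ and ε₂ apply; hence the two ratio bounds change places.
    · obtain ⟨q, hq⟩ := hc'.nonempty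
      obtain ⟨p, rfl⟩ := F.surjective q
      obtain ⟨hρ', hu', hcp, hrange⟩ := projectionRange_of_mem_medialAxis hc' hq
      have hcball := medialAxis_subset_ball hr hFSball hFSsphere hc'
      rw [hcp] at hcball
      set ρ' := ‖c' - F p‖
      set u' := ρ'⁻¹ • (c' - F p)
      have hp : p ∈ S := (F.injective.mem_set_image).1 hq.1
      obtain ⟨ρ, h1, h2, h3, h4, h5⟩ := exists_projectionRange_image hFSball hFSsphere hF.symm
        hFsphere' hq.1 hu' hρ' hrange hcball
      have hρr := ((coe_le_projectionRange_iff hq.1 hρ').1 hrange.ge).le_of_mem_ball hFSsphere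
        (hFSball hq.1) hu' hρ' hcball
      obtain ⟨h6, h7⟩ := radius_ratio_le hρ' h2 (hF.symm.one_le hu') LDF.coe_nonneg hρr hrL h4 h5
      have hu := hF.symm.norm_imageNormal (F p) hu'
      have hun := hF.symm.imageNormal_symm (F p) hu'
      rw [F.symm_symm, F.symm_apply_apply] at hun
      rw [F.symm_apply_apply, F.symm_image_image] at h1
      have h8 := norm_add_smul_sub_le_distortionBound hF (hε₁ p) (hε₂ p) hε hu h2 hρ' h3 hρr
        h7 h6
      rw [hun, ← hcp, norm_sub_rev] at h8
      exact infEDist_le_ofReal_of_mem_closure (add_smul_mem_closure_medialAxis hS hp hu h2 h1) h8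
  refine ⟨?_, hH, ?_⟩
  · rintro c hc p hp u u' rfl rfl
    exact (main c hc p hp).1
  · rwa [hausdorffEDist_closure_left, hausdorffEDist_closure_right]
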